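/- Let $\Omega$ be the set of counting paths: all $\omega\colon\mathbb{R}_{\ge0}\to\mathbb{Z}_{\ge0}$ with $\omega(0)=0$ that are non-decreasing, right-continuous and have only jumps of size one. A stopping time is a map $\tau\colon\Omega\to[0,+\infty]$ such that $\tau(\varpi)=\tau(\omega)$ whenever $\varpi=\omega$ on $[0,\tau(\omega)]\cap\mathbb{R}_{\ge0}$. For a stopping time $\tau$ and $\omega\in\Omega$, let $E_\tau(\omega)$ be the set of $\varpi\in\Omega$ that agree with $\omega$ on $[0,\tau(\omega)]\cap\mathbb{R}_{\ge0}$. A real variable $h$ whose domain includes $\{\tau<+\infty\}$ is $\tau$-measurable if it is constant on $E_\tau(\omega)$ for all $\omega$ in its domain. Fix rate bounds $0\le\underline\lambda\le\overline\lambda<+\infty$. A trading strategy $G$ consists of finitely many stopping times $\tau_1\le\dots\le\tau_n\le\tau_{n+1}$ and, for each $k\in\{1,\dots,n\}$, two bounded, nonnegative, $\tau_k$-measurable real variables $\overline h_k,\underline h_k$ whose domains include $\{\tau_k<+\infty\}$. With initial capital $c\in\mathbb{R}$, its capital at time $t\in\mathbb{R}_{\ge0}$ on the path $\omega$ is $$\mathcal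 K^{G,c}_t(\omega)=c+\sum_{k=1}^n\Big[\overline h_k(\omega)\big(\Delta N_k-\overline\lambda\,\Delta_k\big)+\underline h_k(\omega)\big(\underline\lambda\,\Delta_k-\Delta N_k\big)\Big],$$ where $\Delta_k=(\tau_{k+1}(\omega)\wedge t)-(\tau_k(\omega)\wedge t)$, $\Delta N_k=\omega(\tau_{k+1}(\omega)\wedge t)-\omega(\tau_k(\omega)\wedge t)$, and terms with $\tau_k(\omega)\wedge t=\tau_{k+1}(\omega)\wedge t$ are zero. Let $\mathfrak K$ be the set of all these capital processes. For a stopping time $\tau$, an extended real variable $f$ whose domain includes $\{\tau<+\infty\}$, and $\omega\in\Omega$ with $\tau(\omega)<+\infty$, define the conditional upper and lower expectations $$\overline{\mathrm E}_\tau[f](\omega)=\inf\Big\{\mathcal K_{\tau(\omega)}(\omega)\colon \mathcal K_\bullet\in\mathfrak K,\ \inf_{t\ge0,\,\varpi\in\Omega}\mathcal K_t(\varpi)>-\infty,\ \liminf_{t\to+\infty}\mathcal K_t(\varpi)\ge f(\varpi)\text{ for all }\varpi\in E_\tau(\omega)\Big\},\qquad \underline{\mathrm E}_\tau[f](\omega)=-\overline{\mathrm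 E}_\tau[-f](\omega).$$ For $\omega$ with $\tau(\omega)<+\infty$, let $\rho_\tau(\omega)=\inf\{r\in(\tau(\omega),+\infty)\colon\omega(r)>\omega(\tau(\omega))\}$ (with $\inf\emptyset=+\infty$) be the time of the next jump after $\tau$. **Proposition.** For every stopping time $\tau$ and every $\omega\in\Omega$ with $\tau(\omega)<+\infty$, $$\overline{\mathrm E}_\tau[\rho_\tau-\tau](\omega)=\frac1{\underline\lambda}\qquad\text{and}\qquad\underline{\mathrm E}_\tau[\rho_\tau-\tau](\omega)=\frac1{\overline\lambda},$$ with the convention $1/0=+\infty$. -/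

import Mathlib

open Filter
open scoped NNReal ENNReal

noncomputable section

namespace ImprecisePoisson

/-- Counting paths `ω : ℝ≥0 → ℕ`: they start in `0`, are increasing (in the weak sense),
right-continuous, and only have unit jumps. -/
structure CountingPath where
  toFun : ℝ≥0 → ℕ
  map_zero : toFun 0 = 0
  mono : Monotone toFun
  right_cont : ∀ t : ℝ≥0, ContinuousWithinAt toFun (Set.Ici t) t
  /-- For an increasing `ℕ`-valued path the left limit at `t > 0` is the maximum of the values
  `toFun s` with `s < t`, so this says that the jump at `t` has size at most one. -/
  unit_jumps : ∀ t : ℝ≥0, 0 < t → ∃ s : ℝ≥0, s < t ∧ toFun t ≤ toFun s + 1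

instance : CoeFun CountingPath (fun _ => ℝ≥0 → ℕ) := ⟨CountingPath.toFun⟩

/-- The counting paths that agree with `ω` on `[0, τ(ω)] ∩ ℝ≥0`. -/
def agreeUpTo (τ : CountingPath → ℝ≥0∞) (ω : CountingPath) : Set CountingPath :=
  {ϖ | ∀ s : ℝ≥0, (s : ℝ≥0∞) ≤ τ ω → ϖ s = ω s}

/-- Stopping times, with values in `[0, +∞]`. -/
def IsStopTime (τ : CountingPath → ℝ≥0∞) : Prop :=
  ∀ ω ϖ : CountingPath, ϖ ∈ agreeUpTo τ ω → τ ϖ = τ ω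

/-- `h` is an admissible stake for a bet that starts at `τ`: restricted to `{τ < +∞}`, it is a
positive (that is, nonnegative), bounded and `τ`-measurable real variable. The values of `h` on
`{τ = +∞}` are immaterial, so a partial variable on `{τ < +∞}` is represented by any of its
extensions. -/
structure IsStake (τ : CountingPath → ℝ≥0∞) (h : CountingPath → ℝ) : Prop where
  nonneg : ∀ ω, τ ω < ⊤ → 0 ≤ h ω
  bounded : ∃ B : ℝ, ∀ ω, τ ω < ⊤ → h ω ≤ B
  measurable : ∀ ω, τ ω < ⊤ → ∀ ϖ ∈ agreeUpTo τ ω, h ϖ = h ω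

/-- One-sided elementary trading strategies: stopping times `τ₁ ≤ ⋯ ≤ τₙ ≤ τₙ₊₁` and stakes
on a large (`stakeUp`) and on a small (`stakeDown`) increment between `τₖ` and `τₖ₊₁`. -/
structure Strategy where
  n : ℕ
  time : Fin (n + 1) → CountingPath → ℝ≥0∞
  isStopTime : ∀ k, IsStopTime (time k)
  time_le : ∀ (k : Fin n) (ω : CountingPath), time k.castSucc ω ≤ time k.succ ω
  stakeUp : Fin n → CountingPath → ℝ
  stakeDown : Fin n → CountingPath → ℝ
  isStake_up : ∀ k : Fin n, IsStake (time k.castSucc) (stakeUp k)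
  isStake_down : ∀ k : Fin n, IsStake (time k.castSucc) (stakeDown k)

/-- The real time point `τ(ω) ∧ t`. -/
def stopMin (τ : CountingPath → ℝ≥0∞) (t : ℝ≥0) (ω : CountingPath) : ℝ≥0 :=
  (min (τ ω) (t : ℝ≥0∞)).toNNReal

/-- The capital at time `t` of a trader with initial capital `c` and strategy `G`, when the rate
bounds are `lo` and `hi`. -/
def capital (lo hi : ℝ≥0) (G : Strategy) (c : ℝ) (t : ℝ≥0) (ω : CountingPath) : ℝ :=
  c + ∑ k : Fin G.n,
    (G.stakeUp k ω *
        (((ω (stopMin (G.time k.succ) t ω) : ℝ) - (ω (stopMin (G.time k.castSucc) t ω) : ℝ))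
          - (hi : ℝ) * ((stopMin (G.time k.succ) t ω : ℝ)
              - (stopMin (G.time k.castSucc) t ω : ℝ)))
      + G.stakeDown k ω *
        ((lo : ℝ) * ((stopMin (G.time k.succ) t ω : ℝ)
              - (stopMin (G.time k.castSucc) t ω : ℝ))
          - ((ω (stopMin (G.time k.succ) t ω) : ℝ)
              - (ω (stopMin (G.time k.castSucc) t ω) : ℝ))))

/-- The set of one-sided elementary capital processes for the rate bounds `lo` and `hi`. -/
def capitalProcesses (lo hi : ℝ≥0) : Set (ℝ≥0 → CountingPath → ℝ) :=
  {K | ∃ (G : Strategy) (c : ℝ), K = capital lo hi G c}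

/-- The conditional upper expectation of `f` at `τ` on the path `ω`, for `τ ω < ⊤`: the infimum
of the capital at `τ(ω)` over all capital processes that are bounded below and whose limit
inferior dominates `f` on all paths that agree with `ω` up to `τ(ω)`. Only the values of `f` on
`agreeUpTo τ ω`, a subset of `{τ < +∞}`, matter. -/
def upperExp (lo hi : ℝ≥0) (τ : CountingPath → ℝ≥0∞) (f : CountingPath → EReal)
    (ω : CountingPath) : EReal :=
  sInf {x : EReal | ∃ K ∈ capitalProcesses lo hi,
    (∃ b : ℝ, ∀ (t : ℝ≥0) (ϖ : CountingPath), b ≤ K t ϖ) ∧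
    (∀ ϖ ∈ agreeUpTo τ ω, f ϖ ≤ liminf (fun t : ℝ≥0 => ((K t ϖ : ℝ) : EReal)) atTop) ∧
    x = ((K (τ ω).toNNReal ω : ℝ) : EReal)}

/-- The conditional lower expectation, defined by conjugacy. -/
def lowerExp (lo hi : ℝ≥0) (τ : CountingPath → ℝ≥0∞) (f : CountingPath → EReal)
    (ω : CountingPath) : EReal :=
  -upperExp lo hi τ (fun ϖ => -f ϖ) ω

/-- The time `ρ_τ` of the next jump after `τ`: the infimum (`⊤` for the empty set) of all
`r ∈ (τ(ω), +∞)` with `ω(r) > ω(τ(ω))`. It equals `⊤` on `{τ = +∞}`. -/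
def nextJump (τ : CountingPath → ℝ≥0∞) (ω : CountingPath) : ℝ≥0∞ :=
  sInf {x : ℝ≥0∞ | ∃ r : ℝ≥0, x = (r : ℝ≥0∞) ∧ τ ω < (r : ℝ≥0∞) ∧ ω (τ ω).toNNReal < ω r}

/-- The waiting time `ρ_τ - τ` until the next jump after `τ`; relevant on `{τ < +∞}` only. -/
def waitingTime (τ : CountingPath → ℝ≥0∞) (ω : CountingPath) : EReal :=
  (nextJump τ ω : EReal) - (τ ω : EReal)

end ImprecisePoisson

end

/-!
The waiting time `ρ - τ` is priced by explicit hedges in one direction, and in the other by paths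
on which a trader with too little capital fails. No probability is involved.

*Hedges.* Staking `1 / lo` on a small increment from `τ` until the next jump turns the capital
`1 / lo` into at least the waiting time (`upperExp_waitingTime_le`). For the negated waiting time,
the stake `1 / hi` on a large increment would do, but the capital must stay bounded below, so
trading has to stop at some time. On the grid `τ + k / hi` the stake is therefore reduced a little in
such a way that a surplus over `-1 / hi` doubles in each interval without a jump
(`neg_le_doubling_hedge`); an initial surplus of `2⁻ᴹ / hi` then suffices for `M` intervals
(`upperExp_neg_waitingTime_le`).

*Necessity.* After the jump the capital can be kept from growing (`exists_continuation`): the stakes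
of a stage are known when it begins, and the next stretch of the path is chosen against them.
Hence a hedge of `σ (ρ - τ)`, with `σ = ±1`, must be worth `σ (r - τ)` immediately if the jump
comes at `r`. Let `g` be the capital along the path that does not jump after `τ`, with
right derivative `γ`. A jump just after `r` adds some `d` to the capital, and `γ ≤ -lam d` for each
rate `lam` in `[lo, hi]` (`exists_affine_right`), so `γ ≤ lam (g r - σ (r - τ))`. If
`g τ < σ / lam`, then Grönwall's argument drives `g` to `-∞` exponentially, although the capital is bounded
below (`div_le_of_hasDerivWithinAt_right`, `div_le_capital`). It remains to take `lam = lo` for `σ = 1`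
and `lam = hi` for `σ = -1`.

The rates `0` are separate: if `lo = 0`, the capital cannot grow without jumps, while the waiting
time is infinite (`capital_le_of_no_jump`), and if `hi = 0`, loans that are paid back at the
next jump are free (`upperExp_neg_waitingTime_le_neg`).
-/

noncomputable section

namespace ImprecisePoisson

/-! ### Constructing counting paths -/

/-- The path that never jumps. -/
def zeroPath : CountingPath where
  toFun _ := 0
  map_zero := rfl
  mono := monotone_const
  right_cont _ := continuousWithinAt_const
  unit_jumps _ ht := ⟨0, ht, zero_le⟩

/-- The path with a single jump, at time `r`. -/
def singleJump (r : ℝ≥0) (hr : 0 < r) : CountingPath where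
  toFun t := if r ≤ t then 1 else 0
  map_zero := if_neg hr.not_ge
  mono s t hst := by
    by_cases h : r ≤ s
    · simp [h, h.trans hst]
    · simp [h]
  right_cont t := by
    by_cases h : r ≤ t
    · refine (continuousWithinAt_const (b := 1)).congr (fun y hy => ?_) (if_pos h)
      exact if_pos (h.trans hy)
    · refine ContinuousAt.continuousWithinAt ?_
      refine (continuousAt_const (y := 0)).congr ?_
      filter_upwards [Iio_mem_nhds (not_le.1 h)] with y hy
      exact (if_neg (not_le.2 hy)).symm
  unit_jumps t ht := ⟨0, ht, by split_ifs <;> simp⟩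

/-- The path that jumps periodically at rate `a`. The phase `θ` close to `1` makes the first jump
come almost immediately, so that the path stays above `a t - (1 - θ)`. -/
def periodicPath (a θ : ℝ≥0) (hθ : θ < 1) : CountingPath where
  toFun t := ⌊a * t + θ⌋₊
  map_zero := by simpa using hθ
  mono s t hst := Nat.floor_mono (by gcongr)
  right_cont t := by
    have h1 : ∀ᶠ y in nhdsWithin t (Set.Ici t), a * y + θ < (⌊a * t + θ⌋₊ + 1 : ℝ≥0) := by
      have hc : Continuous fun y : ℝ≥0 => a * y + θ := by fun_prop
      exact nhdsWithin_le_nhds (hc.continuousAt.eventually_lt_const (Nat.lt_floor_add_one _))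
    refine (continuousWithinAt_const (b := ⌊a * t + θ⌋₊)).congr_of_eventuallyEq ?_ rfl
    filter_upwards [h1, self_mem_nhdsWithin] with y hy hty
    rw [Nat.floor_eq_iff zero_le]
    refine ⟨(Nat.floor_le zero_le).trans ?_, hy⟩
    have : t ≤ y := hty
    gcongr
  unit_jumps t ht := by
    refine ⟨t - 1 / (a + 1), tsub_lt_self ht (by positivity), ?_⟩
    rw [← Nat.floor_add_one zero_le]
    apply Nat.floor_mono
    have h1 : a * (1 / (a + 1)) ≤ 1 := by
      rw [mul_one_div]
      exact div_le_one_of_le₀ (by simp) zero_le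
    have h2 : t ≤ (t - 1 / (a + 1)) + 1 / (a + 1) := le_tsub_add
    calc a * t + θ ≤ a * ((t - 1 / (a + 1)) + 1 / (a + 1)) + θ := by gcongr
      _ = a * (t - 1 / (a + 1)) + θ + a * (1 / (a + 1)) := by ring
      _ ≤ _ := by gcongr

/-- The path that follows `ω` up to time `v` and adds the jumps of `ψ`, restarted at `v`,
afterwards. -/
def splice (ω : CountingPath) (v : ℝ≥0) (ψ : CountingPath) : CountingPath where
  toFun t := ω (min t v) + ψ (t - v)
  map_zero := by simp [ω.map_zero, ψ.map_zero]
  mono s t hst := add_le_add (ω.mono (min_le_min_right v hst)) (ψ.mono (tsub_le_tsub_right hst v))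
  right_cont t := by
    refine ContinuousWithinAt.add ?_ ?_
    · exact (ω.right_cont (min t v)).comp (f := fun t => min t v)
        (by fun_prop) (fun y hy => min_le_min_right v hy)
    · exact (ψ.right_cont (t - v)).comp (f := fun t => t - v)
        (by fun_prop) (fun y hy => tsub_le_tsub_right hy v)
  unit_jumps t ht := by
    rcases le_or_gt t v with h | h
    · obtain ⟨s, hs, hs'⟩ := ω.unit_jumps t ht
      refine ⟨s, hs, ?_⟩
      simpa [h, hs.le.trans h, tsub_eq_zero_of_le, ψ.map_zero] using hs'
    · obtain ⟨s, hs, hs'⟩ := ψ.unit_jumps (t - v) (tsub_pos_of_lt h)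
      refine ⟨s + v, lt_tsub_iff_right.1 hs, ?_⟩
      simpa [h.le, add_assoc] using hs'

theorem splice_apply_of_le (ω : CountingPath) {v t : ℝ≥0} (ψ : CountingPath) (h : t ≤ v) :
    splice ω v ψ t = ω t := by
  change ω (min t v) + ψ (t - v) = ω t
  rw [min_eq_left h, tsub_eq_zero_of_le h, ψ.map_zero, add_zero]

theorem splice_apply_of_ge (ω : CountingPath) {v t : ℝ≥0} (ψ : CountingPath) (h : v ≤ t) :
    splice ω v ψ t = ω v + ψ (t - v) := by
  change ω (min t v) + ψ (t - v) = _
  rw [min_eq_right h]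

/-! ### Stopping times and nonanticipation -/

theorem IsStopTime.eq_of_agree {τ : CountingPath → ℝ≥0∞} (hτ : IsStopTime τ)
    {ω ϖ : CountingPath} {v : ℝ≥0} (h : ∀ s ≤ v, ϖ s = ω s) (hv : τ ω ≤ v) : τ ϖ = τ ω :=
  hτ ω ϖ fun s hs => h s (by exact_mod_cast hs.trans hv)

theorem IsStopTime.eq_of_agree_lt {τ : CountingPath → ℝ≥0∞} (hτ : IsStopTime τ)
    {ω ϖ : CountingPath} {v : ℝ≥0} (h : ∀ s < v, ϖ s = ω s) (hv : τ ω < v) : τ ϖ = τ ω :=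
  hτ ω ϖ fun s hs => h s (by exact_mod_cast hs.trans_lt hv)

/-- Two paths that agree before `v` cannot be told apart by a stopping time before `v`. -/
theorem IsStopTime.le_of_agree_lt {τ : CountingPath → ℝ≥0∞} (hτ : IsStopTime τ)
    {ω ϖ : CountingPath} {v : ℝ≥0} (h : ∀ s < v, ϖ s = ω s) (hv : v ≤ τ ω) : v ≤ τ ϖ := by
  by_contra! hlt
  rw [hτ.eq_of_agree_lt (fun s hs => (h s hs).symm) hlt] at hv
  exact hlt.not_ge hv

theorem IsStopTime.min {σ τ : CountingPath → ℝ≥0∞} (hσ : IsStopTime σ) (hτ : IsStopTime τ) :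
    IsStopTime fun ω => min (σ ω) (τ ω) := by
  intro ω ϖ h
  rcases le_total (σ ω) (τ ω) with hle | hle
  · have h' : ∀ s : ℝ≥0, (s : ℝ≥0∞) ≤ σ ω → ϖ s = ω s := by
      simpa [agreeUpTo, hle] using h
    have e := hσ ω ϖ h'
    have : σ ω ≤ τ ϖ := by
      by_contra! hlt
      have := hτ ϖ ω fun s hs => (h' s (hs.trans hlt.le)).symm
      exact hlt.not_ge (this ▸ hle)
    simp [e, hle, this]
  · have h' : ∀ s : ℝ≥0, (s : ℝ≥0∞) ≤ τ ω → ϖ s = ω s := by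
      simpa [agreeUpTo, hle] using h
    have e := hτ ω ϖ h'
    have : τ ω ≤ σ ϖ := by
      by_contra! hlt
      have := hσ ϖ ω fun s hs => (h' s (hs.trans hlt.le)).symm
      exact hlt.not_ge (this ▸ hle)
    simp [e, hle, this]

theorem IsStopTime.add_const {τ : CountingPath → ℝ≥0∞} (hτ : IsStopTime τ) (a : ℝ≥0∞) :
    IsStopTime fun ω => τ ω + a := fun ω ϖ h => by
  have e : τ ϖ = τ ω := hτ ω ϖ fun s hs => h s (hs.trans le_self_add)
  simp [e]

theorem stopMin_eq_self {τ : CountingPath → ℝ≥0∞} {t : ℝ≥0} {ω : CountingPath} (h : t ≤ τ ω) :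
    stopMin τ t ω = t := by
  simp [stopMin, h]

theorem coe_stopMin (τ : CountingPath → ℝ≥0∞) (t : ℝ≥0) (ω : CountingPath) :
    (stopMin τ t ω : ℝ≥0∞) = min (τ ω) t :=
  ENNReal.coe_toNNReal (ne_top_of_le_ne_top ENNReal.coe_ne_top (min_le_right _ _))

theorem stopMin_le (τ : CountingPath → ℝ≥0∞) (t : ℝ≥0) (ω : CountingPath) :
    stopMin τ t ω ≤ t := by
  have := coe_stopMin τ t ω
  exact_mod_cast this.le.trans (min_le_right _ _)

theorem stopMin_eq_toNNReal {τ : CountingPath → ℝ≥0∞} {t : ℝ≥0} {ω : CountingPath}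
    (h : τ ω ≤ t) : stopMin τ t ω = (τ ω).toNNReal := by
  simp [stopMin, h]

theorem stopMin_mono {σ τ : CountingPath → ℝ≥0∞} {t : ℝ≥0} {ω : CountingPath}
    (h : σ ω ≤ τ ω) : stopMin σ t ω ≤ stopMin τ t ω := by
  have : (stopMin σ t ω : ℝ≥0∞) ≤ stopMin τ t ω := by
    rw [coe_stopMin, coe_stopMin]; exact min_le_min_right _ h
  exact_mod_cast this

theorem stopMin_mono_right (τ : CountingPath → ℝ≥0∞) {u t : ℝ≥0} (ω : CountingPath)
    (h : u ≤ t) : stopMin τ u ω ≤ stopMin τ t ω := by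
  have : (stopMin τ u ω : ℝ≥0∞) ≤ stopMin τ t ω := by
    rw [coe_stopMin, coe_stopMin]; exact min_le_min_left _ (by exact_mod_cast h)
  exact_mod_cast this

theorem stopMin_congr {τ : CountingPath → ℝ≥0∞} (hτ : IsStopTime τ)
    {ω ϖ : CountingPath} {t : ℝ≥0} (h : ∀ s < t, ϖ s = ω s) :
    stopMin τ t ϖ = stopMin τ t ω := by
  rcases lt_or_ge (τ ω) t with h1 | h1
  · rw [stopMin, stopMin, hτ.eq_of_agree_lt h h1]
  · rw [stopMin_eq_self h1, stopMin_eq_self (hτ.le_of_agree_lt h h1)]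

/-- The gain from the stakes `a` (on a large increment) and `b` (on a small increment) over a
stage of length `x` with `N` jumps. -/
def betGain (lo hi : ℝ≥0) (a b N x : ℝ) : ℝ :=
  a * (N - hi * x) + b * (lo * x - N)

@[simp] theorem betGain_zero (lo hi : ℝ≥0) (a b : ℝ) : betGain lo hi a b 0 0 = 0 := by
  simp [betGain]

theorem capital_eq (lo hi : ℝ≥0) (G : Strategy) (c : ℝ) (t : ℝ≥0) (ω : CountingPath) :
    capital lo hi G c t ω = c + ∑ k : Fin G.n, betGain lo hi (G.stakeUp k ω) (G.stakeDown k ω)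
      ((ω (stopMin (G.time k.succ) t ω) : ℝ) - ω (stopMin (G.time k.castSucc) t ω))
      ((stopMin (G.time k.succ) t ω : ℝ) - stopMin (G.time k.castSucc) t ω) := rfl

/-- The capital at `t` depends on the path up to `t` only. -/
theorem capital_congr (lo hi : ℝ≥0) (G : Strategy) (c : ℝ) {t : ℝ≥0} {ω ϖ : CountingPath}
    (h : ∀ s ≤ t, ϖ s = ω s) : capital lo hi G c t ϖ = capital lo hi G c t ω := by
  rw [capital_eq, capital_eq]
  congr 1
  refine Finset.sum_congr rfl fun k _ => ?_
  rw [stopMin_congr (G.isStopTime _) fun s hs => h s hs.le,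
    stopMin_congr (G.isStopTime _) fun s hs => h s hs.le,
    h _ (stopMin_le _ _ _), h _ (stopMin_le _ _ _)]
  rcases le_or_gt (G.time k.castSucc ω) t with h1 | h1
  · have hfin : G.time k.castSucc ω < ⊤ := h1.trans_lt ENNReal.coe_lt_top
    have hag : ϖ ∈ agreeUpTo (G.time k.castSucc) ω :=
      fun s hs => h s (by exact_mod_cast hs.trans h1)
    rw [(G.isStake_up k).measurable ω hfin ϖ hag, (G.isStake_down k).measurable ω hfin ϖ hag]
  · rw [stopMin_eq_self h1.le, stopMin_eq_self (h1.le.trans (G.time_le k ω))]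
    simp

/-- The time `τ(ω) ∧ t`, clamped to `[u, t]`. -/
def clampTime (τ : CountingPath → ℝ≥0∞) (u t : ℝ≥0) (ω : CountingPath) : ℝ≥0 :=
  max u (stopMin τ t ω)

theorem clampTime_of_le {τ : CountingPath → ℝ≥0∞} {u t : ℝ≥0} {ω : CountingPath}
    (h : τ ω ≤ u) : clampTime τ u t ω = u := by
  have : (stopMin τ t ω : ℝ≥0∞) ≤ u := (coe_stopMin _ _ _).le.trans ((min_le_left _ _).trans h)
  exact max_eq_left (by exact_mod_cast this)

theorem clampTime_of_ge {τ : CountingPath → ℝ≥0∞} {u t : ℝ≥0} {ω : CountingPath} (hut : u ≤ t)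
    (h : t ≤ τ ω) : clampTime τ u t ω = t := by
  rw [clampTime, stopMin_eq_self h, max_eq_right hut]

theorem sub_stopMin_eq {E : Type*} [AddGroup E] (f : ℝ≥0 → E) (τ : CountingPath → ℝ≥0∞)
    {u t : ℝ≥0} (hut : u ≤ t) (ω : CountingPath) :
    f (stopMin τ t ω) - f (stopMin τ u ω) = f (clampTime τ u t ω) - f u := by
  rcases le_or_gt (τ ω) u with h | h
  · rw [clampTime_of_le h, stopMin_eq_toNNReal h,
      stopMin_eq_toNNReal (h.trans (by exact_mod_cast hut)), sub_self, sub_self]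
  · have h1 : u ≤ stopMin τ t ω := by
      rw [← stopMin_eq_self h.le]; exact stopMin_mono_right _ _ hut
    rw [clampTime, max_eq_right h1, stopMin_eq_self h.le]

/-- The capital increment over `[u, t]`, stage by stage. -/
theorem capital_sub (lo hi : ℝ≥0) (G : Strategy) (c : ℝ) {u t : ℝ≥0} (hut : u ≤ t)
    (ω : CountingPath) :
    capital lo hi G c t ω - capital lo hi G c u ω =
      ∑ k : Fin G.n, betGain lo hi (G.stakeUp k ω) (G.stakeDown k ω)
        ((ω (clampTime (G.time k.succ) u t ω) : ℝ) - ω (clampTime (G.time k.castSucc) u t ω))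
        ((clampTime (G.time k.succ) u t ω : ℝ) - clampTime (G.time k.castSucc) u t ω) := by
  rw [capital_eq, capital_eq, add_sub_add_left_eq_sub, ← Finset.sum_sub_distrib]
  refine Finset.sum_congr rfl fun k _ => ?_
  have h1 := sub_stopMin_eq (fun x => (ω x : ℝ)) (G.time k.succ) hut ω
  have h2 := sub_stopMin_eq (fun x => (ω x : ℝ)) (G.time k.castSucc) hut ω
  have h3 := sub_stopMin_eq (fun x => (x : ℝ)) (G.time k.succ) hut ω
  have h4 := sub_stopMin_eq (fun x => (x : ℝ)) (G.time k.castSucc) hut ω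
  simp only [betGain]
  linear_combination
    (G.stakeUp k ω - G.stakeDown k ω) * (h1 - h2)
      + (G.stakeDown k ω * lo - G.stakeUp k ω * hi) * (h3 - h4)

/-! ### Continuations along which the capital does not grow -/

/-- One stage of the continuation: against the stakes `a` and `b`, the path stops jumping when
`a ≥ b`, and jumps periodically at rate `lo`, starting almost at once, when `a < b`. -/
theorem exists_path_betGain_le {lo hi : ℝ≥0} (hle : lo ≤ hi) {a b ε : ℝ} (ha : 0 ≤ a)
    (hε : 0 < ε) : ∃ ψ : CountingPath, ∀ x : ℝ≥0, betGain lo hi a b (ψ x) x ≤ ε := by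
  have hle' : (lo : ℝ) ≤ hi := by exact_mod_cast hle
  rcases le_or_gt b a with h | h
  · refine ⟨zeroPath, fun x => ?_⟩
    have hx : (0 : ℝ) ≤ x := x.2
    have hlo : (0 : ℝ) ≤ lo := lo.2
    have h1 : b * lo ≤ a * hi := by
      calc b * lo ≤ a * lo := by gcongr
        _ ≤ a * hi := by gcongr
    have h2 : betGain lo hi a b (zeroPath x) x = -((a * hi - b * lo) * x) := by
      have : zeroPath x = 0 := rfl
      rw [this, betGain]; push_cast; ring
    rw [h2]
    nlinarith [mul_nonneg (sub_nonneg.2 h1) hx]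
  · have hd : 0 < b - a := sub_pos.2 h
    -- the phase `θ = 1 - η` costs at most `(b - a) η ≤ ε`
    obtain ⟨η, hη0, hη1, hη⟩ : ∃ η : ℝ, 0 < η ∧ η ≤ 1 ∧ (b - a) * η ≤ ε := by
      refine ⟨min 1 (ε / (b - a)), by positivity, min_le_left _ _, ?_⟩
      calc (b - a) * min 1 (ε / (b - a)) ≤ (b - a) * (ε / (b - a)) := by
            gcongr; exact min_le_right _ _
        _ = ε := by field_simp
    have hθ : ((1 - η).toNNReal : ℝ) = 1 - η := Real.coe_toNNReal _ (by linarith)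
    refine ⟨periodicPath lo (1 - η).toNNReal ?_, fun x => ?_⟩
    · rw [← NNReal.coe_lt_coe, hθ]; simpa using hη0
    · set N : ℕ := ⌊lo * x + (1 - η).toNNReal⌋₊
      change betGain lo hi a b (N : ℝ) x ≤ ε
      have hN : (lo : ℝ) * x + (1 - η) < N + 1 := by
        have h3 := Nat.lt_floor_add_one (lo * x + (1 - η).toNNReal)
        rw [← NNReal.coe_lt_coe] at h3
        push_cast [hθ] at h3
        exact h3
      have hx : (0 : ℝ) ≤ x := x.2
      have h4 : betGain lo hi a b N x
          = (b - a) * (lo * x - N) - a * ((hi - lo) * x) := by rw [betGain]; ring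
      have h5 : 0 ≤ a * ((hi - lo) * x) :=
        mul_nonneg ha (mul_nonneg (sub_nonneg.2 hle') hx)
      have h6 : (b - a) * (lo * x - N) ≤ (b - a) * η := by gcongr; linarith
      linarith

/-- From any time `u` on, any path has a continuation along which the capital never grows by more
than `ε`. It is built stage by stage, since the stakes of a stage are known when it begins. -/
theorem exists_continuation {lo hi : ℝ≥0} (hle : lo ≤ hi) (G : Strategy) (c : ℝ)
    (ω : CountingPath) (u : ℝ≥0) {ε : ℝ} (hε : 0 < ε) :
    ∃ ϖ : CountingPath, (∀ s ≤ u, ϖ s = ω s) ∧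
      ∀ t, u ≤ t → capital lo hi G c t ϖ ≤ capital lo hi G c u ω + ε := by
  set δ : ℝ := ε / (G.n + 1)
  have hδ : 0 < δ := by positivity
  have key : ∀ m : ℕ, m ≤ G.n → ∃ ϖ : CountingPath, (∀ s ≤ u, ϖ s = ω s) ∧
      ∀ k : Fin G.n, (k : ℕ) < m → ∀ t, u ≤ t →
        betGain lo hi (G.stakeUp k ϖ) (G.stakeDown k ϖ)
        ((ϖ (clampTime (G.time k.succ) u t ϖ) : ℝ) - ϖ (clampTime (G.time k.castSucc) u t ϖ))
        ((clampTime (G.time k.succ) u t ϖ : ℝ) - clampTime (G.time k.castSucc) u t ϖ) ≤ δ := by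
    intro m
    induction m with
    | zero => exact fun _ => ⟨ω, fun _ _ => rfl, fun k hk => absurd hk (Nat.not_lt_zero _)⟩
    | succ m ih =>
      intro hm
      obtain ⟨ω', hω', hgain⟩ := ih (Nat.le_of_succ_le hm)
      let j : Fin G.n := ⟨m, hm⟩
      rcases eq_or_ne (G.time j.castSucc ω') ⊤ with htop | hfin
      · -- the stage `j` never begins
        refine ⟨ω', hω', fun k hk t hut => ?_⟩
        rcases Nat.lt_succ_iff_lt_or_eq.1 hk with hk | hk
        · exact hgain k hk t hut
        · obtain rfl : k = j := Fin.ext hk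
          have htop' : G.time j.succ ω' = ⊤ := top_le_iff.1 (htop ▸ G.time_le j ω')
          rw [clampTime_of_ge hut (le_top.trans_eq htop.symm),
            clampTime_of_ge hut (le_top.trans_eq htop'.symm)]
          simpa using hδ.le
      · obtain ⟨T, hT⟩ : ∃ T : ℝ≥0, (T : ℝ≥0∞) = G.time j.castSucc ω' :=
          ⟨_, ENNReal.coe_toNNReal hfin⟩
        have hTfin : G.time j.castSucc ω' < ⊤ := hfin.lt_top
        set v : ℝ≥0 := max u T
        have huv : u ≤ v := le_max_left _ _
        have hTv : G.time j.castSucc ω' ≤ v := by rw [← hT]; exact_mod_cast le_max_right _ _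
        obtain ⟨ψ, hψ⟩ := exists_path_betGain_le hle
          ((G.isStake_up j).nonneg ω' hTfin) (b := G.stakeDown j ω') hδ
        set ϖ := splice ω' v ψ
        have hag : ∀ s ≤ v, ϖ s = ω' s := fun s hs => splice_apply_of_le ω' ψ hs
        have hmono : Monotone fun i => G.time i ω' :=
          Fin.monotone_iff_le_succ.2 fun i => G.time_le i ω'
        -- all stages up to `j` begin by time `v`, with unchanged times and stakes
        have htime : ∀ i : Fin (G.n + 1), i ≤ j.castSucc → G.time i ϖ = G.time i ω' :=
          fun i hi => (G.isStopTime i).eq_of_agree hag ((hmono hi).trans hTv)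
        have hstake : ∀ k : Fin G.n, (k : ℕ) ≤ m →
            G.stakeUp k ϖ = G.stakeUp k ω' ∧ G.stakeDown k ϖ = G.stakeDown k ω' := by
          intro k hk
          have hkj : G.time k.castSucc ω' ≤ v :=
            (hmono (show k.castSucc ≤ j.castSucc from hk)).trans hTv
          have hk' : G.time k.castSucc ω' < ⊤ := hkj.trans_lt ENNReal.coe_lt_top
          have hagk : ϖ ∈ agreeUpTo (G.time k.castSucc) ω' :=
            fun s hs => hag s (by exact_mod_cast hs.trans hkj)
          exact ⟨(G.isStake_up k).measurable ω' hk' ϖ hagk,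
            (G.isStake_down k).measurable ω' hk' ϖ hagk⟩
        have hclamp : ∀ i : Fin (G.n + 1), i ≤ j.castSucc → ∀ t,
            clampTime (G.time i) u t ϖ = clampTime (G.time i) u t ω' ∧
            clampTime (G.time i) u t ω' ≤ v := by
          intro i hi t
          refine ⟨by rw [clampTime, clampTime, stopMin, stopMin, htime i hi], max_le huv ?_⟩
          have : (stopMin (G.time i) t ω' : ℝ≥0∞) ≤ v :=
            (coe_stopMin _ _ _).le.trans ((min_le_left _ _).trans ((hmono hi).trans hTv))
          exact_mod_cast this
        refine ⟨ϖ, fun s hs => (hag s (hs.trans huv)).trans (hω' s hs), fun k hk t hut => ?_⟩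
        rcases Nat.lt_succ_iff_lt_or_eq.1 hk with hk | hk
        · obtain ⟨e1, e1'⟩ := hclamp k.succ (show (k : ℕ) + 1 ≤ m from hk) t
          obtain ⟨e2, e2'⟩ := hclamp k.castSucc (show (k : ℕ) ≤ m from hk.le) t
          rw [e1, e2, hag _ e1', hag _ e2', (hstake k hk.le).1, (hstake k hk.le).2]
          exact hgain k hk t hut
        · obtain rfl : k = j := Fin.ext hk
          rw [(hstake j le_rfl).1, (hstake j le_rfl).2]
          have hj : clampTime (G.time j.castSucc) u t ϖ = min v t := by
            rw [(hclamp _ le_rfl t).1, clampTime]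
            have hmin : stopMin (G.time j.castSucc) t ω' = min T t := by
              have := coe_stopMin (G.time j.castSucc) t ω'
              rw [← hT] at this
              exact_mod_cast this
            rw [hmin, max_min_distrib_left, max_eq_right hut]
          set q := clampTime (G.time j.succ) u t ϖ
          have hq : min v t ≤ q := by
            rw [← hj]; exact max_le_max_left _ (stopMin_mono (G.time_le j ϖ))
          have hqt : q ≤ t := max_le hut (stopMin_le _ _ _)
          rw [hj]
          rcases le_total v t with hvt | htv
          · rw [min_eq_left hvt] at hq ⊢
            have h1 := hψ (q - v)
            rw [NNReal.coe_sub hq] at h1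
            rw [splice_apply_of_ge ω' ψ hq, hag v le_rfl]
            push_cast
            simpa using h1
          · rw [min_eq_right htv] at hq ⊢
            rw [le_antisymm hqt hq]
            simpa using hδ.le
  obtain ⟨ϖ, hϖ, hgain⟩ := key G.n le_rfl
  refine ⟨ϖ, hϖ, fun t hut => ?_⟩
  rw [← capital_congr lo hi G c hϖ, ← sub_le_iff_le_add', capital_sub lo hi G c hut]
  calc _ ≤ ∑ _k : Fin G.n, δ := Finset.sum_le_sum fun k _ => hgain k k.2 t hut
    _ = G.n * δ := by simp
    _ ≤ (G.n + 1) * δ := by gcongr; linarith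
    _ = ε := by simp only [δ]; field_simp

/-! ### The capital along a path without jumps -/

/-- Just after `r`, the stakes do not change before the next jump: on a path that agrees with `ω`
before `t`, the capital at `t` is affine in `t - r` and in the size of the jump at `t`.
The slope `γ` in time is at most `-lam` times the coefficient `d` of the jump, for each admissible
rate `lam`. -/
theorem exists_affine_right {lo hi : ℝ≥0} (G : Strategy) (c : ℝ) (ω : CountingPath) (r : ℝ≥0) :
    ∃ r₁ > r, ∃ γ d : ℝ, (∀ lam : ℝ≥0, lo ≤ lam → lam ≤ hi → γ ≤ -lam * d) ∧
      ∀ t, r < t → t < r₁ → ∀ ϖ : CountingPath, (∀ s < t, ϖ s = ω s) →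
        capital lo hi G c t ϖ
          = capital lo hi G c r ω + γ * (t - r) + d * ((ϖ t : ℝ) - ω r) := by
  classical
  -- no trading time of `ω` lies in `(r, r₁)`
  obtain ⟨r₁, hr₁, hnext⟩ : ∃ r₁ > r, ∀ i, (r : ℝ≥0∞) < G.time i ω → (r₁ : ℝ≥0∞) ≤ G.time i ω := by
    have h1 : ∀ᶠ x : ℝ≥0 in nhdsWithin r (Set.Ioi r),
        ∀ i, (r : ℝ≥0∞) < G.time i ω → (x : ℝ≥0∞) ≤ G.time i ω := by
      refine eventually_all.2 fun i => nhdsWithin_le_nhds ?_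
      by_cases h : (r : ℝ≥0∞) < G.time i ω
      · filter_upwards [ENNReal.continuous_coe.continuousAt.eventually_lt_const h] with x hx _
        exact hx.le
      · exact Eventually.of_forall fun x hx => absurd hx h
    obtain ⟨x, hx, hx'⟩ := (h1.and self_mem_nhdsWithin).exists
    exact ⟨x, hx', hx⟩
  let A : Finset (Fin G.n) := {k | G.time k.castSucc ω ≤ r ∧ (r : ℝ≥0∞) < G.time k.succ ω}
  refine ⟨r₁, hr₁, ∑ k ∈ A, (G.stakeDown k ω * lo - G.stakeUp k ω * hi),
    ∑ k ∈ A, (G.stakeUp k ω - G.stakeDown k ω), fun lam h1 h2 => ?_, fun t hrt htr ϖ hϖ => ?_⟩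
  · rw [Finset.mul_sum]
    refine Finset.sum_le_sum fun k hk => ?_
    have hk' : G.time k.castSucc ω < ⊤ := by
      simp only [A, Finset.mem_filter] at hk
      exact hk.2.1.trans_lt ENNReal.coe_lt_top
    have ha := (G.isStake_up k).nonneg ω hk'
    have hb := (G.isStake_down k).nonneg ω hk'
    have h1' : (lo : ℝ) ≤ lam := by exact_mod_cast h1
    have h2' : (lam : ℝ) ≤ hi := by exact_mod_cast h2
    nlinarith [mul_nonneg ha (sub_nonneg.2 h2'), mul_nonneg hb (sub_nonneg.2 h1')]
  · have hagr : ∀ s ≤ r, ϖ s = ω s := fun s hs => hϖ s (hs.trans_lt hrt)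
    rw [← capital_congr lo hi G c hagr, add_assoc, ← sub_eq_iff_eq_add',
      capital_sub lo hi G c hrt.le, Finset.sum_mul, Finset.sum_mul, ← Finset.sum_add_distrib,
      ← Finset.sum_filter_add_sum_filter_not Finset.univ (fun k : Fin G.n => k ∈ A)]
    have hbefore : ∀ i, G.time i ω ≤ r → clampTime (G.time i) r t ϖ = r := fun i hi => by
      rw [clampTime_of_le]
      rwa [(G.isStopTime i).eq_of_agree hagr hi]
    have hafter : ∀ i, (r : ℝ≥0∞) < G.time i ω → clampTime (G.time i) r t ϖ = t := fun i hi => by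
      refine clampTime_of_ge hrt.le ((G.isStopTime i).le_of_agree_lt hϖ ?_)
      exact le_trans (by exact_mod_cast htr.le) (hnext i hi)
    have hrest : ∑ k with k ∉ A, betGain lo hi (G.stakeUp k ϖ) (G.stakeDown k ϖ)
        ((ϖ (clampTime (G.time k.succ) r t ϖ) : ℝ) - ϖ (clampTime (G.time k.castSucc) r t ϖ))
        ((clampTime (G.time k.succ) r t ϖ : ℝ) - clampTime (G.time k.castSucc) r t ϖ) = 0 := by
      refine Finset.sum_eq_zero fun k hk => ?_
      simp only [A, Finset.mem_filter, Finset.mem_univ, true_and, not_and, not_lt] at hk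
      rcases le_or_gt (G.time k.castSucc ω) r with h | h
      · rw [hbefore _ h, hbefore _ (hk h)]; simp
      · rw [hafter _ h, hafter _ (h.trans_le (G.time_le k ω))]; simp
    rw [hrest, add_zero, Finset.filter_univ_mem]
    refine Finset.sum_congr rfl fun k hk => ?_
    simp only [A, Finset.mem_filter, Finset.mem_univ, true_and] at hk
    have hk' : G.time k.castSucc ω < ⊤ := hk.1.trans_lt ENNReal.coe_lt_top
    have hag : ϖ ∈ agreeUpTo (G.time k.castSucc) ω :=
      fun s hs => hagr s (by exact_mod_cast hs.trans hk.1)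
    rw [hbefore _ hk.1, hafter _ hk.2, (G.isStake_up k).measurable ω hk' ϖ hag,
      (G.isStake_down k).measurable ω hk' ϖ hag, hagr r le_rfl, betGain]
    ring

theorem continuous_stopMin (τ : CountingPath → ℝ≥0∞) (ω : CountingPath) :
    Continuous fun t => stopMin τ t ω := by
  refine ENNReal.isEmbedding_coe.continuous_iff.2 ?_
  have : ((↑) : ℝ≥0 → ℝ≥0∞) ∘ (fun t => stopMin τ t ω) = fun t : ℝ≥0 => min (τ ω) (t : ℝ≥0∞) :=
    funext fun t => coe_stopMin τ t ω
  rw [this]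
  exact continuous_const.min ENNReal.continuous_coe

/-- The capital is continuous along a path as long as it does not jump. -/
theorem continuousOn_capital (lo hi : ℝ≥0) (G : Strategy) (c : ℝ) {ω : CountingPath} {s : ℝ≥0}
    (h : ∀ t, s ≤ t → ω t = ω s) :
    ContinuousOn (fun t => capital lo hi G c t ω) (Set.Ici s) := by
  have hconst : ∀ τ : CountingPath → ℝ≥0∞, ∀ t ∈ Set.Ici s,
      ω (stopMin τ t ω) = ω (stopMin τ s ω) := by
    intro τ t ht
    rcases le_or_gt (τ ω) s with h1 | h1
    · rw [stopMin_eq_toNNReal h1, stopMin_eq_toNNReal (h1.trans (by exact_mod_cast ht))]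
    · have h2 : s ≤ stopMin τ t ω := by
        rw [← stopMin_eq_self h1.le]; exact stopMin_mono_right _ _ ht
      rw [h _ h2, stopMin_eq_self h1.le]
  have hc : Continuous fun t => c + ∑ k : Fin G.n,
      betGain lo hi (G.stakeUp k ω) (G.stakeDown k ω)
      ((ω (stopMin (G.time k.succ) s ω) : ℝ) - ω (stopMin (G.time k.castSucc) s ω))
      ((stopMin (G.time k.succ) t ω : ℝ) - stopMin (G.time k.castSucc) t ω) := by
    have h1 := fun i => continuous_stopMin (G.time i) ω
    unfold betGain
    fun_prop
  refine hc.continuousOn.congr fun t ht => ?_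
  simp only [capital_eq, hconst _ t ht]

/-! ### The time of the next jump -/

/-- A counting path is constant to the right of each time, for a while. -/
theorem CountingPath.exists_eq_right (ω : CountingPath) (t : ℝ≥0) :
    ∃ u > t, ∀ y, t ≤ y → y < u → ω y = ω t := by
  have h : ∀ᶠ y in nhdsWithin t (Set.Ici t), ω y = ω t := by
    have := ω.right_cont t
    rw [ContinuousWithinAt, nhds_discrete, tendsto_pure] at this
    exact this
  obtain ⟨u, hu, hu'⟩ := (mem_nhdsGE_iff_exists_Ico_subset' (lt_add_one t)).1 h
  exact ⟨u, hu, fun y h1 h2 => hu' ⟨h1, h2⟩⟩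

section NextJump

variable {τ : CountingPath → ℝ≥0∞} {ω : CountingPath} {s : ℝ≥0}

theorem le_nextJump (τ : CountingPath → ℝ≥0∞) (ω : CountingPath) : τ ω ≤ nextJump τ ω :=
  le_sInf fun _ ⟨_, hx, h, _⟩ => hx ▸ h.le

theorem nextJump_eq_coe (hs : τ ω = s) {r : ℝ≥0} (hsr : s < r)
    (h1 : ∀ t, s ≤ t → t < r → ω t = ω s) (h2 : ω s < ω r) : nextJump τ ω = r := by
  refine le_antisymm (sInf_le ⟨r, rfl, by rw [hs]; exact_mod_cast hsr, by simpa [hs] using h2⟩)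
    (le_sInf ?_)
  rintro x ⟨t, rfl, h3, h4⟩
  rw [hs] at h3 h4
  by_contra! h5
  exact h4.ne' (h1 t (by exact_mod_cast h3.le) (by exact_mod_cast h5))

theorem nextJump_eq_top (hs : τ ω = s) (h : ∀ t, s ≤ t → ω t = ω s) : nextJump τ ω = ⊤ := by
  refine sInf_eq_top.2 ?_
  rintro x ⟨t, rfl, h3, h4⟩
  rw [hs] at h3 h4
  exact absurd (h t (by exact_mod_cast h3.le)) h4.ne'

theorem apply_eq_of_lt_nextJump (hs : τ ω = s) {t : ℝ≥0} (hst : s ≤ t)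
    (ht : t < nextJump τ ω) : ω t = ω s := by
  rcases hst.eq_or_lt with rfl | hst'
  · rfl
  · refine le_antisymm (not_lt.1 fun hlt => ht.not_ge (sInf_le ⟨t, rfl, ?_, ?_⟩)) (ω.mono hst)
    · rw [hs]; exact_mod_cast hst'
    · simpa [hs] using hlt

theorem lt_nextJump (hs : τ ω = s) : s < nextJump τ ω := by
  obtain ⟨u, hu, hu'⟩ := ω.exists_eq_right s
  refine lt_of_lt_of_le (show (s : ℝ≥0∞) < u by exact_mod_cast hu) (le_sInf ?_)
  rintro x ⟨t, rfl, h3, h4⟩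
  rw [hs] at h3 h4
  by_contra! h5
  exact h4.ne' (hu' t (by exact_mod_cast h3.le) (by exact_mod_cast h5))

theorem apply_nextJump (hs : τ ω = s) {r : ℝ≥0} (hr : nextJump τ ω = r) : ω r = ω s + 1 := by
  have hsr : s < r := by have := lt_nextJump hs; rw [hr] at this; exact_mod_cast this
  refine le_antisymm ?_ (Nat.succ_le_of_lt ?_)
  · obtain ⟨t, ht, ht'⟩ := ω.unit_jumps r (zero_le.trans_lt hsr)
    have : ω (max s t) = ω s := apply_eq_of_lt_nextJump hs (le_max_left _ _)
      (by rw [hr]; exact_mod_cast max_lt hsr ht)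
    have := ω.mono (le_max_right s t)
    omega
  · refine lt_of_le_of_ne (ω.mono hsr.le) fun heq => ?_
    obtain ⟨u, hu, hu'⟩ := ω.exists_eq_right r
    have : (u : ℝ≥0∞) ≤ nextJump τ ω := by
      refine le_sInf ?_
      rintro x ⟨t, rfl, h3, h4⟩
      rw [hs] at h3 h4
      simp only [ENNReal.toNNReal_coe] at h4
      by_contra! h5
      have h5' : t < u := by exact_mod_cast h5
      rcases lt_or_ge t r with h6 | h6
      · exact h4.ne' (apply_eq_of_lt_nextJump hs (by exact_mod_cast h3.le)
          (by rw [hr]; exact_mod_cast h6))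
      · rw [hu' t h6 h5', heq] at h4
        exact lt_irrefl _ h4
    rw [hr] at this
    exact hu.not_ge (by exact_mod_cast this)

theorem isStopTime_nextJump (hτ : IsStopTime τ) : IsStopTime (nextJump τ) := by
  intro ω ϖ h
  have hτ' : τ ϖ = τ ω := hτ ω ϖ fun t ht => h t (ht.trans (le_nextJump τ ω))
  rcases eq_or_ne (nextJump τ ω) ⊤ with htop | hfin
  · have : ϖ = ω := by
      have h' : ϖ.toFun = ω.toFun := funext fun t => h t (le_top.trans_eq htop.symm)
      cases ϖ; cases ω; simpa using h'
    rw [this]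
  · have hr := (ENNReal.coe_toNNReal hfin).symm
    set r := (nextJump τ ω).toNNReal
    have hs := (ENNReal.coe_toNNReal (ne_top_of_le_ne_top hfin (le_nextJump τ ω))).symm
    set s := (τ ω).toNNReal
    have hsr : s < r := by have := lt_nextJump hs; rw [hr] at this; exact_mod_cast this
    have hag : ∀ t ≤ r, ϖ t = ω t := fun t ht => h t (by rw [hr]; exact_mod_cast ht)
    rw [hr]
    refine nextJump_eq_coe (hτ'.trans hs) hsr (fun t h1 h2 => ?_) ?_
    · rw [hag t h2.le, hag s hsr.le]
      exact apply_eq_of_lt_nextJump hs h1 (by rw [hr]; exact_mod_cast h2)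
    · rw [hag s hsr.le, hag r le_rfl, apply_nextJump hs hr]
      exact Nat.lt_succ_self _

theorem waitingTime_eq_coe (hs : τ ω = s) {r : ℝ≥0} (hr : nextJump τ ω = r) :
    waitingTime τ ω = ((r - s : ℝ) : EReal) := by
  rw [waitingTime, hs, hr, EReal.coe_sub]; rfl

theorem waitingTime_eq_top (hs : τ ω = s) (hr : nextJump τ ω = ⊤) : waitingTime τ ω = ⊤ := by
  rw [waitingTime, hs, hr, EReal.coe_ennreal_top]
  exact EReal.top_sub_coe s

end NextJump

/-! ### Lower bounds on the cost of superhedging -/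

/-- Compare `g` with the solution `φ x = σ (x - s) + σ / lam` of `φ' = lam (φ - σ (x - s))`: if
`g s < φ s`, then `φ - g` grows exponentially and `g` is not bounded below. -/
theorem div_le_of_hasDerivWithinAt_right {g : ℝ → ℝ} {s lam σ b : ℝ} (hlam : 0 < lam)
    (hg : ContinuousOn g (Set.Ici s))
    (hderiv : ∀ x, s ≤ x → ∃ γ, HasDerivWithinAt g γ (Set.Ici x) x ∧ γ ≤ lam * (g x - σ * (x - s)))
    (hb : ∀ x, s ≤ x → b ≤ g x) : σ / lam ≤ g s := by
  by_contra! hlt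
  have hF : ∀ x, s ≤ x →
      Real.exp (-lam * (x - s)) * (g x - (σ * (x - s) + σ / lam)) ≤ g s - σ / lam := by
    intro x hx
    choose! γ hγ hγ' using hderiv
    refine image_le_of_deriv_right_le_deriv_boundary
      (f := fun x => Real.exp (-lam * (x - s)) * (g x - (σ * (x - s) + σ / lam)))
      (f' := fun x => (Real.exp (-lam * (x - s)) * (-lam * 1)) * (g x - (σ * (x - s) + σ / lam))
        + Real.exp (-lam * (x - s)) * (γ x - σ * 1))
      (B := fun _ => g s - σ / lam) (B' := fun _ => 0) (a := s) (b := x) ?_ ?_ ?_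
      continuousOn_const (fun _ _ => hasDerivWithinAt_const _ _ _) ?_ ⟨hx, le_rfl⟩
    · have : ContinuousOn g (Set.Icc s x) := hg.mono Set.Icc_subset_Ici_self
      fun_prop
    · intro y hy
      have h1 : HasDerivWithinAt (fun y => y - s) 1 (Set.Ici y) y :=
        (hasDerivWithinAt_id _ _).sub_const s
      exact (h1.const_mul (-lam)).exp.mul
        ((hγ y hy.1).sub ((h1.const_mul σ).add_const (σ / lam)))
    · simp
    · intro y hy
      have h2 := hγ' y hy.1
      have h3 : lam * (σ / lam) = σ := by field_simp
      have h4 : (Real.exp (-lam * (y - s)) * (-lam * 1)) * (g y - (σ * (y - s) + σ / lam))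
          + Real.exp (-lam * (y - s)) * (γ y - σ * 1)
          = -(Real.exp (-lam * (y - s)) * (lam * (g y - σ * (y - s)) - γ y)) := by
        linear_combination Real.exp (-lam * (y - s)) * h3
      rw [h4, neg_nonpos]
      exact mul_nonneg (Real.exp_pos _).le (sub_nonneg.2 h2)
  set δ := σ / lam - g s
  have hδ : 0 < δ := sub_pos.2 hlt
  -- as `x → ∞`, `δ exp (lam x)` outgrows `σ x + σ / lam - b`
  have hquad : ∀ x, 0 ≤ x → δ * (1 + lam * x + (lam * x) ^ 2 / 2) ≤ σ * x + σ / lam - b := by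
    intro x hx
    have h1 := hF (s + x) (by linarith)
    rw [add_sub_cancel_left] at h1
    have h2 := mul_le_mul_of_nonneg_left h1 (Real.exp_pos (lam * x)).le
    rw [← mul_assoc, ← Real.exp_add] at h2
    simp only [neg_mul, add_neg_cancel, Real.exp_zero, one_mul] at h2
    have h3 := Real.quadratic_le_exp_of_nonneg (mul_nonneg hlam.le hx)
    have h4 := hb (s + x) (by linarith)
    have h5 := mul_le_mul_of_nonneg_left h3 hδ.le
    have h6 : g s - σ / lam = -δ := by simp [δ]
    rw [h6] at h2
    linarith
  set C := |σ| + |σ / lam - b|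
  have hC : 0 ≤ C := by positivity
  set x := 1 + 2 * C / (δ * lam ^ 2)
  have hx : 1 ≤ x := le_add_of_nonneg_right (by positivity)
  have h1 := hquad x (by linarith)
  have h2 : σ * x + σ / lam - b ≤ C * x := by
    have h3 : σ * x ≤ |σ| * x := by gcongr; exact le_abs_self σ
    have h4 : σ / lam - b ≤ |σ / lam - b| * x :=
      (le_abs_self _).trans (le_mul_of_one_le_right (abs_nonneg _) hx)
    simp only [C]; linarith
  have h5 : δ * lam ^ 2 * x = δ * lam ^ 2 + 2 * C := by simp only [x]; field_simp
  have h6 : δ * ((lam * x) ^ 2 / 2) = C * x + δ * lam ^ 2 * x / 2 := by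
    linear_combination (x / 2) * h5
  have h7 : 0 < δ * lam ^ 2 * x / 2 := by positivity
  have h8 : 0 ≤ δ * (1 + lam * x) := by positivity
  linarith

/-- Some continuation keeps the capital from exceeding its value at `r` by more than `ε`, so
superhedging a variable that is known at `r` requires that value at `r` already. -/
theorem le_capital_of_le_liminf {lo hi : ℝ≥0} (hle : lo ≤ hi) (G : Strategy) (c : ℝ)
    (ω : CountingPath) (r : ℝ≥0) {x : ℝ}
    (h : ∀ ϖ : CountingPath, (∀ t ≤ r, ϖ t = ω t) →
      (x : EReal) ≤ liminf (fun t : ℝ≥0 => ((capital lo hi G c t ϖ : ℝ) : EReal)) atTop) :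
    x ≤ capital lo hi G c r ω := by
  refine le_of_forall_pos_le_add fun ε hε => ?_
  obtain ⟨ϖ, hϖ, hcap⟩ := exists_continuation hle G c ω r hε
  have h1 : liminf (fun t : ℝ≥0 => ((capital lo hi G c t ϖ : ℝ) : EReal)) atTop
      ≤ ((capital lo hi G c r ω + ε : ℝ) : EReal) := by
    refine liminf_le_of_frequently_le' (Eventually.frequently ?_)
    filter_upwards [eventually_ge_atTop r] with t ht
    exact_mod_cast hcap t ht
  exact_mod_cast (h ϖ hϖ).trans h1

/-- If a capital process is bounded below and superhedges `σ (ρ - τ)` on all paths that do jump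
after `τ`, then at `τ` it is worth at least `σ / lam`, for each positive rate `lam` in
`[lo, hi]`. -/
theorem div_le_capital {lo hi lam : ℝ≥0} (hlo : lo ≤ lam) (hhi : lam ≤ hi) (hlam : 0 < lam)
    {τ : CountingPath → ℝ≥0∞} (hτ : IsStopTime τ) {ω : CountingPath} {s : ℝ≥0} (hs : τ ω = s)
    (G : Strategy) (c : ℝ) {b : ℝ} (hb : ∀ t ϖ, b ≤ capital lo hi G c t ϖ) (σ : ℝ)
    (h : ∀ ϖ ∈ agreeUpTo τ ω, ∀ r : ℝ≥0, nextJump τ ϖ = r → ((σ * (r - s) : ℝ) : EReal)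
      ≤ liminf (fun t : ℝ≥0 => ((capital lo hi G c t ϖ : ℝ) : EReal)) atTop) :
    σ / lam ≤ capital lo hi G c s ω := by
  set ω₀ := splice ω s zeroPath
  have hω₀s : ∀ t ≤ s, ω₀ t = ω t := fun t ht => splice_apply_of_le ω zeroPath ht
  have hω₀ : ∀ t, s ≤ t → ω₀ t = ω s := fun t ht => splice_apply_of_ge ω zeroPath ht
  have hjump : ∀ t (hst : s < t), σ * (t - s)
      ≤ capital lo hi G c t (splice ω s (singleJump (t - s) (tsub_pos_of_lt hst))) := by
    intro t hst
    refine le_capital_of_le_liminf (hlo.trans hhi) G c _ t fun ϖ hϖ => ?_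
    have hag : ∀ u ≤ s, ϖ u = ω u := fun u hu =>
      (hϖ u (hu.trans hst.le)).trans (splice_apply_of_le _ _ hu)
    have hτϖ : τ ϖ = s := (hτ.eq_of_agree hag hs.le).trans hs
    refine h ϖ (fun u hu => hag u (by rw [hs] at hu; exact_mod_cast hu)) t
      (nextJump_eq_coe hτϖ hst (fun u hu hut => ?_) ?_)
    · rw [hϖ u hut.le, hag s le_rfl, splice_apply_of_ge _ _ hu]
      have : singleJump (t - s) (tsub_pos_of_lt hst) (u - s) = 0 :=
        if_neg (not_le.2 (tsub_lt_tsub_right_of_le hu hut))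
      rw [this, add_zero]
    · rw [hϖ t le_rfl, hag s le_rfl, splice_apply_of_ge _ _ hst.le]
      have : singleJump (t - s) (tsub_pos_of_lt hst) (t - s) = 1 := if_pos le_rfl
      omega
  rw [← capital_congr lo hi G c hω₀s]
  have hmain := div_le_of_hasDerivWithinAt_right (lam := lam) (σ := σ) (b := b) (s := s)
    (g := fun x : ℝ => capital lo hi G c x.toNNReal ω₀) (by exact_mod_cast hlam) ?_ ?_
    (fun x _ => hb _ _)
  · simpa using hmain
  · refine (continuousOn_capital lo hi G c (ω := ω₀) (s := s) fun t ht => ?_).comp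
      continuous_real_toNNReal.continuousOn fun x hx => ?_
    · rw [hω₀ t ht, hω₀ s le_rfl]
    · exact NNReal.le_toNNReal_of_coe_le hx
  · intro x hx
    lift x to ℝ≥0 using s.2.trans hx with r
    have hsr : s ≤ r := by exact_mod_cast hx
    obtain ⟨r₁, hr₁, γ, d, hγ, haff⟩ := exists_affine_right (lo := lo) (hi := hi) G c ω₀ r
    refine ⟨γ, ?_, ?_⟩
    · have h1 : HasDerivWithinAt (fun y : ℝ => capital lo hi G c r ω₀ + γ * (y - r)) γ
          (Set.Ici (r : ℝ)) r := by
        have := ((hasDerivWithinAt_id (r : ℝ) (Set.Ici (r : ℝ))).sub_const (r : ℝ)).const_mul γ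
        simpa using this.const_add (capital lo hi G c r ω₀)
      refine h1.congr_of_eventuallyEq ?_ (by simp)
      have hlt : (r : ℝ) < r₁ := by exact_mod_cast hr₁
      filter_upwards [Ico_mem_nhdsGE hlt] with y hy
      lift y to ℝ≥0 using r.2.trans hy.1
      rcases (show r ≤ y by exact_mod_cast hy.1).eq_or_lt with rfl | hry
      · simp
      · have := haff y hry (by exact_mod_cast hy.2) ω₀ fun _ _ => rfl
        rw [hω₀ y (hsr.trans hry.le), hω₀ r hsr] at this
        simpa using this
    · -- the capital after a jump just after `r` is about `g r + d`
      have hd : σ * (r - s) ≤ capital lo hi G c r ω₀ + d := by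
        have hlim : Tendsto (fun t : ℝ≥0 => capital lo hi G c r ω₀ + γ * ((t : ℝ) - r) + d)
            (nhdsWithin r (Set.Ioi r)) (nhds (capital lo hi G c r ω₀ + γ * ((r : ℝ) - r) + d)) :=
          Continuous.continuousWithinAt (by fun_prop)
        have hlim' : Tendsto (fun t : ℝ≥0 => σ * ((t : ℝ) - s))
            (nhdsWithin r (Set.Ioi r)) (nhds (σ * ((r : ℝ) - s))) :=
          Continuous.continuousWithinAt (by fun_prop)
        rw [sub_self, mul_zero, add_zero] at hlim
        refine le_of_tendsto_of_tendsto hlim' hlim ?_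
        filter_upwards [Ioo_mem_nhdsGT hr₁] with t ht
        have hst : s < t := hsr.trans_lt ht.1
        have h1 := hjump t hst
        rw [haff t ht.1 ht.2, splice_apply_of_ge _ _ hst.le, hω₀ r hsr] at h1
        · have : singleJump (t - s) (tsub_pos_of_lt hst) (t - s) = 1 := if_pos le_rfl
          rw [this] at h1
          push_cast at h1
          linarith
        · intro u hut
          rcases le_total u s with hus | hsu
          · rw [splice_apply_of_le _ _ hus, hω₀s u hus]
          · have : singleJump (t - s) (tsub_pos_of_lt hst) (u - s) = 0 :=
              if_neg (not_le.2 (tsub_lt_tsub_right_of_le hsu hut))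
            rw [splice_apply_of_ge _ _ hsu, hω₀ u hsu, this, add_zero]
      have h2 := hγ lam hlo hhi
      have hlam' : (0 : ℝ) ≤ lam := lam.2
      simp only [Real.toNNReal_coe]
      nlinarith [mul_le_mul_of_nonneg_left hd hlam']

/-- Without a positive lower rate there is nothing to gain from the absence of jumps. -/
theorem capital_le_of_no_jump {hi : ℝ≥0} (G : Strategy) (c : ℝ) {ω : CountingPath} {s : ℝ≥0}
    (h : ∀ t, s ≤ t → ω t = ω s) {t : ℝ≥0} (hst : s ≤ t) :
    capital 0 hi G c t ω ≤ capital 0 hi G c s ω := by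
  rw [← sub_nonpos, capital_sub 0 hi G c hst]
  refine Finset.sum_nonpos fun k _ => ?_
  have hN : ∀ σ, ω (clampTime σ s t ω) = ω s := fun _ => h _ (le_max_left _ _)
  rw [hN, hN, sub_self]
  rcases lt_or_ge (G.time k.castSucc ω) ⊤ with hfin | htop
  · have h1 : (clampTime (G.time k.castSucc) s t ω : ℝ) ≤ clampTime (G.time k.succ) s t ω := by
      exact_mod_cast max_le_max_left s (stopMin_mono (G.time_le k ω))
    have h2 := mul_nonneg ((G.isStake_up k).nonneg ω hfin)
      (mul_nonneg hi.2 (sub_nonneg.2 h1))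
    simp only [betGain, NNReal.coe_zero]
    simp only [NNReal.val_eq_coe] at h2
    linarith
  · rw [clampTime_of_ge hst (le_top.trans htop),
      clampTime_of_ge hst ((le_top.trans htop).trans (G.time_le k ω)), sub_self]
    simp

/-! ### Hedging the waiting time -/

section Hedging

variable {τ : CountingPath → ℝ≥0∞}

theorem isStake_const (σ : CountingPath → ℝ≥0∞) (a : ℝ≥0) : IsStake σ fun _ => a where
  nonneg _ _ := a.2
  bounded := ⟨a, fun _ _ => le_rfl⟩
  measurable _ _ _ _ := rfl

/-- The time `τ + a`, or the next jump after `τ` if that comes first. -/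
def jumpTime (τ : CountingPath → ℝ≥0∞) (a : ℝ≥0∞) (ω : CountingPath) : ℝ≥0∞ :=
  min (nextJump τ ω) (τ ω + a)

theorem jumpTime_zero (τ : CountingPath → ℝ≥0∞) : jumpTime τ 0 = τ :=
  funext fun ω => by simp [jumpTime, le_nextJump]

theorem jumpTime_top (τ : CountingPath → ℝ≥0∞) : jumpTime τ ⊤ = nextJump τ :=
  funext fun ω => by simp [jumpTime]

theorem le_jumpTime (τ : CountingPath → ℝ≥0∞) (a : ℝ≥0∞) (ω : CountingPath) :
    τ ω ≤ jumpTime τ a ω :=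
  le_min (le_nextJump τ ω) le_self_add

/-- The strategy that bets from `τ` until the next jump with stakes that depend on the time elapsed
since `τ` only: they are the constants `up k` and `down k` between `τ + a k` and `τ + a (k + 1)`. -/
def jumpBet (hτ : IsStopTime τ) (a : ℕ → ℝ≥0∞) (ha : Monotone a) (n : ℕ) (up down : ℕ → ℝ≥0) :
    Strategy where
  n := n
  time k := jumpTime τ (a k)
  isStopTime _ := (isStopTime_nextJump hτ).min (hτ.add_const _)
  time_le k _ := min_le_min_left _ (add_le_add_right (ha (Nat.le_succ k)) _)
  stakeUp k _ := up k
  stakeDown k _ := down k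
  isStake_up _ := isStake_const _ _
  isStake_down _ := isStake_const _ _

theorem capital_jumpBet (lo hi : ℝ≥0) (hτ : IsStopTime τ) (a : ℕ → ℝ≥0∞) (ha : Monotone a)
    (n : ℕ) (up down : ℕ → ℝ≥0) (c : ℝ) (t : ℝ≥0) (ω : CountingPath) :
    capital lo hi (jumpBet hτ a ha n up down) c t ω
      = c + ∑ k ∈ Finset.range n, betGain lo hi (up k) (down k)
        ((ω (stopMin (jumpTime τ (a (k + 1))) t ω) : ℝ) - ω (stopMin (jumpTime τ (a k)) t ω))
        ((stopMin (jumpTime τ (a (k + 1))) t ω : ℝ) - stopMin (jumpTime τ (a k)) t ω) := by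
  rw [capital_eq, ← Fin.sum_univ_eq_sum_range (fun k => betGain lo hi (up k) (down k)
        ((ω (stopMin (jumpTime τ (a (k + 1))) t ω) : ℝ) - ω (stopMin (jumpTime τ (a k)) t ω))
        ((stopMin (jumpTime τ (a (k + 1))) t ω : ℝ) - stopMin (jumpTime τ (a k)) t ω)) n]
  rfl

theorem capital_jumpBet_self (lo hi : ℝ≥0) (hτ : IsStopTime τ) (a : ℕ → ℝ≥0∞)
    (ha : Monotone a) (n : ℕ) (up down : ℕ → ℝ≥0) (c : ℝ) {s : ℝ≥0} {ω : CountingPath}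
    (hs : τ ω = s) : capital lo hi (jumpBet hτ a ha n up down) c s ω = c := by
  have h : ∀ b, stopMin (jumpTime τ b) s ω = s :=
    fun b => stopMin_eq_self (hs ▸ le_jumpTime τ b ω)
  simp [capital_jumpBet, h]

/-- A hedge with stakes that depend on the elapsed time only bounds the upper expectation by its
initial capital. -/
theorem upperExp_le (lo hi : ℝ≥0) {f : CountingPath → EReal} {ω : CountingPath} {s : ℝ≥0}
    (hs : τ ω = s) (hτ : IsStopTime τ) (a : ℕ → ℝ≥0∞) (ha : Monotone a) (n : ℕ)
    (up down : ℕ → ℝ≥0) (c : ℝ) (b : ℝ)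
    (hb : ∀ t ϖ, b ≤ capital lo hi (jumpBet hτ a ha n up down) c t ϖ)
    (h : ∀ ϖ, τ ϖ = s → f ϖ ≤ liminf (fun t : ℝ≥0 =>
      ((capital lo hi (jumpBet hτ a ha n up down) c t ϖ : ℝ) : EReal)) atTop) :
    upperExp lo hi τ f ω ≤ c := by
  refine sInf_le ⟨_, ⟨jumpBet hτ a ha n up down, c, rfl⟩, ⟨b, hb⟩,
    fun ϖ hϖ => h ϖ ((hτ ω ϖ hϖ).trans hs), ?_⟩
  rw [hs, ENNReal.toNNReal_coe, capital_jumpBet_self lo hi hτ a ha n up down c hs]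

/-- A single stage, from `τ` until the next jump. -/
theorem capital_jumpBet_one (lo hi : ℝ≥0) (hτ : IsStopTime τ) (ha) (up down : ℝ≥0)
    (c : ℝ) (t : ℝ≥0) (ω : CountingPath) :
    capital lo hi (jumpBet hτ (fun k => if k = 0 then 0 else ⊤) ha 1 (fun _ => up) fun _ => down)
      c t ω = c + betGain lo hi up down
        ((ω (stopMin (nextJump τ) t ω) : ℝ) - ω (stopMin τ t ω))
        ((stopMin (nextJump τ) t ω : ℝ) - stopMin τ t ω) := by
  simp [capital_jumpBet, jumpTime_zero, jumpTime_top]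

theorem monotone_ite_zero_top : Monotone fun k : ℕ => if k = 0 then (0 : ℝ≥0∞) else ⊤ := by
  refine monotone_nat_of_le_succ fun n => ?_
  simp

theorem apply_stopMin_nextJump_le (τ : CountingPath → ℝ≥0∞) (t : ℝ≥0) (ω : CountingPath) :
    ω (stopMin (nextJump τ) t ω) ≤ ω (stopMin τ t ω) + 1 := by
  rcases le_or_gt (t : ℝ≥0∞) (τ ω) with h | h
  · rw [stopMin_eq_self h, stopMin_eq_self (h.trans (le_nextJump τ ω))]
    exact Nat.le_succ _
  · have hs := (ENNReal.coe_toNNReal (h.trans ENNReal.coe_lt_top).ne).symm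
    set s := (τ ω).toNNReal
    have hst : s ≤ t := by rw [hs] at h; exact_mod_cast h.le
    rw [stopMin_eq_toNNReal h.le, hs, ENNReal.toNNReal_coe]
    rcases lt_or_ge (t : ℝ≥0∞) (nextJump τ ω) with h1 | h1
    · rw [stopMin_eq_self h1.le, apply_eq_of_lt_nextJump hs hst h1]
      exact Nat.le_succ _
    · have hr := (ENNReal.coe_toNNReal (h1.trans_lt ENNReal.coe_lt_top).ne).symm
      rw [stopMin_eq_toNNReal h1, apply_nextJump hs hr]

/-- Staking `1 / lo` on a small increment until the next jump turns the initial capital `1 / lo`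
into the waiting time. -/
theorem upperExp_waitingTime_le {lo : ℝ≥0} (hi : ℝ≥0) (hlo : 0 < lo) (hτ : IsStopTime τ)
    {ω : CountingPath} {s : ℝ≥0} (hs : τ ω = s) :
    upperExp lo hi τ (waitingTime τ) ω ≤ ((1 / lo : ℝ) : EReal) := by
  have hlo' : (0 : ℝ) < lo := by exact_mod_cast hlo
  have hcap : ∀ t ϖ, (stopMin (nextJump τ) t ϖ : ℝ) - stopMin τ t ϖ
      ≤ capital lo hi (jumpBet hτ (fun k => if k = 0 then 0 else ⊤) monotone_ite_zero_top 1
        (fun _ => 0) fun _ => 1 / lo) (1 / lo) t ϖ := by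
    intro t ϖ
    rw [capital_jumpBet_one]
    have h1 : (ϖ (stopMin (nextJump τ) t ϖ) : ℝ) ≤ ϖ (stopMin τ t ϖ) + 1 := by
      exact_mod_cast apply_stopMin_nextJump_le τ t ϖ
    set N : ℝ := (ϖ (stopMin (nextJump τ) t ϖ) : ℝ) - ϖ (stopMin τ t ϖ)
    set x : ℝ := (stopMin (nextJump τ) t ϖ : ℝ) - stopMin τ t ϖ
    have h2 : (1 / lo : ℝ) + betGain lo hi (0 : ℝ≥0) (1 / lo : ℝ≥0) N x
        = x + (1 - N) / lo := by
      simp only [betGain]; push_cast; field_simp; ring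
    rw [h2]
    have h3 : 0 ≤ 1 - N := by simp only [N]; linarith
    exact le_add_of_nonneg_right (by positivity)
  refine upperExp_le lo hi hs hτ _ monotone_ite_zero_top 1 (fun _ => 0) (fun _ => 1 / lo) (1 / lo)
    0 (fun t ϖ => le_trans ?_ (hcap t ϖ)) fun ϖ hϖ => ?_
  · exact sub_nonneg.2 (by exact_mod_cast stopMin_mono (le_nextJump τ ϖ))
  · refine le_trans ?_ (liminf_le_liminf (Eventually.of_forall fun t =>
      EReal.coe_le_coe_iff.2 (hcap t ϖ)))
    rcases eq_or_ne (nextJump τ ϖ) ⊤ with htop | hfin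
    · rw [waitingTime_eq_top hϖ htop]
      refine (Tendsto.liminf_eq ?_).ge
      rw [EReal.tendsto_coe_nhds_top_iff]
      have h4 : Tendsto (fun t : ℝ≥0 => (t : ℝ) - s) atTop atTop :=
        tendsto_atTop_add_const_right _ _ (NNReal.tendsto_coe_atTop.2 tendsto_id)
      refine h4.congr' ?_
      filter_upwards [eventually_ge_atTop s] with t ht
      rw [stopMin_eq_self (le_top.trans_eq htop.symm), stopMin_eq_toNNReal, hϖ,
        ENNReal.toNNReal_coe]
      rw [hϖ]; exact_mod_cast ht
    · have hr := (ENNReal.coe_toNNReal hfin).symm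
      set r := (nextJump τ ϖ).toNNReal
      rw [waitingTime_eq_coe hϖ hr]
      refine le_liminf_of_le (by isBoundedDefault) ?_
      filter_upwards [eventually_ge_atTop r] with t ht
      have h5 : nextJump τ ϖ ≤ t := by rw [hr]; exact_mod_cast ht
      rw [stopMin_eq_toNNReal h5, stopMin_eq_toNNReal ((le_nextJump τ ϖ).trans h5), hr, hϖ]
      simp

/-- If large increments are free, a loan of any size `M`, to be paid back at the next jump, hedges
the negated waiting time. -/
theorem upperExp_neg_waitingTime_le_neg (lo : ℝ≥0) (hτ : IsStopTime τ)
    {ω : CountingPath} {s : ℝ≥0} (hs : τ ω = s) (M : ℝ≥0) :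
    upperExp lo 0 τ (fun ϖ => -waitingTime τ ϖ) ω ≤ ((-M : ℝ) : EReal) := by
  have hcap : ∀ t ϖ, capital lo 0 (jumpBet hτ (fun k => if k = 0 then 0 else ⊤)
      monotone_ite_zero_top 1 (fun _ => M) fun _ => 0) (-M) t ϖ
      = -M + M * ((ϖ (stopMin (nextJump τ) t ϖ) : ℝ) - ϖ (stopMin τ t ϖ)) := by
    intro t ϖ
    rw [capital_jumpBet_one, betGain]
    simp
  refine upperExp_le lo 0 hs hτ _ monotone_ite_zero_top 1 (fun _ => M) (fun _ => 0) (-M)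
    (-M) (fun t ϖ => ?_) fun ϖ hϖ => ?_
  · rw [hcap]
    have h1 : (ϖ (stopMin τ t ϖ) : ℝ) ≤ ϖ (stopMin (nextJump τ) t ϖ) := by
      exact_mod_cast ϖ.mono (stopMin_mono (le_nextJump τ ϖ))
    exact le_add_of_nonneg_right (mul_nonneg M.2 (sub_nonneg.2 h1))
  · rcases eq_or_ne (nextJump τ ϖ) ⊤ with htop | hfin
    · simp [waitingTime_eq_top hϖ htop]
    · have hr := (ENNReal.coe_toNNReal hfin).symm
      set r := (nextJump τ ϖ).toNNReal
      have hsr : (s : ℝ) ≤ r := by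
        have := le_nextJump τ ϖ; rw [hr, hϖ] at this; exact_mod_cast this
      rw [waitingTime_eq_coe hϖ hr, ← EReal.coe_neg]
      refine le_liminf_of_le (by isBoundedDefault) ?_
      filter_upwards [eventually_ge_atTop r] with t ht
      have h5 : nextJump τ ϖ ≤ t := by rw [hr]; exact_mod_cast ht
      rw [hcap, stopMin_eq_toNNReal h5, stopMin_eq_toNNReal ((le_nextJump τ ϖ).trans h5), hr, hϖ,
        EReal.coe_le_coe_iff, ENNReal.toNNReal_coe, ENNReal.toNNReal_coe, apply_nextJump hϖ hr]
      push_cast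
      linarith

/-- The arithmetic of hedging `-u`, where `u` is the waiting time, on the time grid `k / hi`:
with capital `(x - 1) / hi - k / hi` at a grid point before the jump, where `x ≤ 1`, the stake
`(1 - x) / hi` suffices if the jump comes in the next grid interval, and doubles the surplus `x`
otherwise. So an initial surplus of `2⁻ᴹ` suffices for `M` intervals. -/
theorem neg_le_doubling_hedge {h u : ℝ} (hh : 0 < h) (M : ℕ) (y N : ℕ → ℝ)
    (hy : ∀ k, y k = min u (k / h)) (hN : ∀ k : ℕ, k / h < u → N k = 0)
    (hN' : ∀ k : ℕ, u ≤ k / h → N k = 1) (hu : 0 < u) :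
    -u ≤ (-1 + 1 / 2 ^ M) / h + ∑ k ∈ Finset.range M,
      (1 - 2 ^ k / 2 ^ M) / h * ((N (k + 1) - N k) - h * (y (k + 1) - y k)) := by
  have key : ∀ m : ℕ, m ≤ M →
      (m / h < u → (-1 + 1 / 2 ^ M) / h + ∑ k ∈ Finset.range m,
        (1 - 2 ^ k / 2 ^ M) / h * ((N (k + 1) - N k) - h * (y (k + 1) - y k))
          = (-1 + 2 ^ m / 2 ^ M) / h - m / h) ∧
      (u ≤ m / h → -u ≤ (-1 + 1 / 2 ^ M) / h + ∑ k ∈ Finset.range m,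
        (1 - 2 ^ k / 2 ^ M) / h * ((N (k + 1) - N k) - h * (y (k + 1) - y k))) := by
    intro m
    induction m with
    | zero =>
      refine fun _ => ⟨fun _ => by simp, fun h0 => ?_⟩
      simp only [Nat.cast_zero, zero_div] at h0
      exact absurd hu h0.not_gt
    | succ m ih =>
      intro hm
      obtain ⟨ih1, ih2⟩ := ih (Nat.le_of_succ_le hm)
      have hstep : ((m + 1 : ℕ) : ℝ) / h = m / h + 1 / h := by push_cast; ring
      have hh' : 0 < 1 / h := by positivity
      rw [Finset.sum_range_succ, ← add_assoc]
      rcases lt_or_ge ((m : ℝ) / h) u with h1 | h1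
      · rw [ih1 h1, hy m, hN m h1, min_eq_right h1.le, hy (m + 1)]
        refine ⟨fun h2 => ?_, fun h2 => ?_⟩
        · rw [hN (m + 1) h2, min_eq_right h2.le]
          push_cast; field_simp; ring
        · rw [hN' (m + 1) h2, min_eq_left h2]
          have hx : (0 : ℝ) ≤ 2 ^ m / 2 ^ M * (u - m / h) :=
            mul_nonneg (by positivity) (sub_nonneg.2 h1.le)
          have e : (-1 + 2 ^ m / 2 ^ M) / h - m / h
              + (1 - 2 ^ m / 2 ^ M) / h * (1 - 0 - h * (u - m / h))
              = -u + 2 ^ m / 2 ^ M * (u - m / h) := by field_simp; ring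
          rw [e]
          linarith
      · have h2 : u ≤ ((m + 1 : ℕ) : ℝ) / h := by rw [hstep]; linarith
        refine ⟨fun h3 => absurd h3 h2.not_gt, fun _ => ?_⟩
        rw [hy m, hy (m + 1), hN' m h1, hN' (m + 1) h2, min_eq_left h1, min_eq_left h2]
        simpa using ih2 h1
  rcases lt_or_ge ((M : ℝ) / h) u with h1 | h1
  · rw [(key M le_rfl).1 h1, div_self (by positivity)]
    simp only [neg_add_cancel, zero_div]
    linarith
  · exact (key M le_rfl).2 h1

/-- The doubling strategy: the initial capital `-1 / hi` plus an arbitrarily small surplus hedges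
the negated waiting time. Staking the constant `1 / hi` forever would be cheaper still, but the capital
would then not be bounded below. -/
theorem upperExp_neg_waitingTime_le (lo : ℝ≥0) {hi : ℝ≥0} (hhi : 0 < hi) (hτ : IsStopTime τ)
    {ω : CountingPath} {s : ℝ≥0} (hs : τ ω = s) (M : ℕ) :
    upperExp lo hi τ (fun ϖ => -waitingTime τ ϖ) ω
      ≤ (((-1 + 1 / 2 ^ M) / hi : ℝ) : EReal) := by
  have hhi' : (0 : ℝ) < hi := by exact_mod_cast hhi
  let a : ℕ → ℝ≥0∞ := fun k => ((k / hi : ℝ≥0) : ℝ≥0∞)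
  have ha : Monotone a := fun i j hij => by
    have : (i : ℝ≥0) / hi ≤ j / hi := by gcongr
    exact ENNReal.coe_le_coe.2 this
  let up : ℕ → ℝ≥0 := fun k => (1 - 2 ^ k / 2 ^ M) / hi
  have hup : ∀ k ∈ Finset.range M, (up k : ℝ) = (1 - 2 ^ k / 2 ^ M) / hi := by
    intro k hk
    have : (2 : ℝ≥0) ^ k / 2 ^ M ≤ 1 := by
      rw [div_le_one₀ (by positivity)]
      exact pow_le_pow_right₀ (by norm_num) (Finset.mem_range.1 hk).le
    simp only [up]
    push_cast [NNReal.coe_sub this]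
    rfl
  have hup_le : ∀ k, (up k : ℝ) ≤ 1 / hi := fun k => by
    have : up k ≤ 1 / hi := by simp only [up]; gcongr; exact tsub_le_self
    exact_mod_cast this
  refine upperExp_le lo hi hs hτ a ha M up (fun _ => 0) _
    ((-1 + 1 / 2 ^ M) / hi + ∑ k ∈ Finset.range M, (-(1 / hi) : ℝ)) (fun t ϖ => ?_) fun ϖ hϖ => ?_
  · rw [capital_jumpBet]
    refine add_le_add_right (Finset.sum_le_sum fun k _ => ?_) _
    have hle : jumpTime τ (a k) ϖ ≤ jumpTime τ (a (k + 1)) ϖ :=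
      min_le_min_left _ (add_le_add_right (ha (Nat.le_succ k)) _)
    have h1 : (ϖ (stopMin (jumpTime τ (a k)) t ϖ) : ℝ)
        ≤ ϖ (stopMin (jumpTime τ (a (k + 1))) t ϖ) := by
      exact_mod_cast ϖ.mono (stopMin_mono hle)
    have h2 : (stopMin (jumpTime τ (a (k + 1))) t ϖ : ℝ)
        ≤ stopMin (jumpTime τ (a k)) t ϖ + 1 / hi := by
      have : (stopMin (jumpTime τ (a (k + 1))) t ϖ : ℝ≥0∞)
          ≤ stopMin (jumpTime τ (a k)) t ϖ + (1 / hi : ℝ≥0) := by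
        rw [coe_stopMin, coe_stopMin, jumpTime, jumpTime, ← min_add_add_right,
          ← min_add_add_right]
        refine min_le_min (min_le_min le_self_add (le_of_eq ?_)) le_self_add
        simp only [a]
        rw [add_assoc, ← ENNReal.coe_add]
        congr 2
        push_cast
        rw [add_div]
      exact_mod_cast this
    have h3 : (hi : ℝ) * ((stopMin (jumpTime τ (a (k + 1))) t ϖ : ℝ)
        - stopMin (jumpTime τ (a k)) t ϖ) ≤ 1 := by
      calc _ ≤ (hi : ℝ) * (1 / hi) := by gcongr; linarith
        _ = 1 := by field_simp
    simp only [betGain, NNReal.coe_zero, zero_mul, add_zero]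
    calc -(1 / hi : ℝ) ≤ -(up k : ℝ) := neg_le_neg (hup_le k)
      _ = (up k : ℝ) * (-1) := by ring
      _ ≤ _ := mul_le_mul_of_nonneg_left (by linarith) (up k).2
  · rcases eq_or_ne (nextJump τ ϖ) ⊤ with htop | hfin
    · simp [waitingTime_eq_top hϖ htop]
    · have hr := (ENNReal.coe_toNNReal hfin).symm
      set r := (nextJump τ ϖ).toNNReal
      have hsr : s < r := by
        have := lt_nextJump hϖ; rw [hr] at this; exact_mod_cast this
      rw [waitingTime_eq_coe hϖ hr, ← EReal.coe_neg]
      refine le_liminf_of_le (by isBoundedDefault) ?_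
      filter_upwards [eventually_ge_atTop r] with t ht
      have htime : ∀ k : ℕ, stopMin (jumpTime τ (a k)) t ϖ = min r (s + k / hi) := by
        intro k
        have h1 := coe_stopMin (jumpTime τ (a k)) t ϖ
        simp only [jumpTime, hr, hϖ, a, ← ENNReal.coe_add, ← ENNReal.coe_min] at h1
        rw [ENNReal.coe_inj.1 h1, min_eq_left ((min_le_left _ _).trans ht)]
      rw [EReal.coe_le_coe_iff, capital_jumpBet]
      have hu : (0 : ℝ) < r - s := sub_pos.2 (by exact_mod_cast hsr)
      refine (neg_le_doubling_hedge hhi' M (u := r - s)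
        (fun k => (stopMin (jumpTime τ (a k)) t ϖ : ℝ) - s)
        (fun k => (ϖ (stopMin (jumpTime τ (a k)) t ϖ) : ℝ) - ϖ s) (fun k => ?_) (fun k hk => ?_)
        (fun k hk => ?_) hu).trans_eq ?_
      · rw [htime k]
        push_cast
        rw [← min_sub_sub_right, add_sub_cancel_left]
      · have hlt : s + k / hi < r := by
          rw [← NNReal.coe_lt_coe]; push_cast; linarith
        simp only [htime k]
        rw [min_eq_right hlt.le, apply_eq_of_lt_nextJump hϖ le_self_add
          (by rw [hr]; exact_mod_cast hlt), sub_self]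
      · have hle : r ≤ s + k / hi := by
          rw [← NNReal.coe_le_coe]; push_cast; linarith
        simp only [htime k]
        rw [min_eq_left hle, apply_nextJump hϖ hr]
        simp
      · congr 1
        refine Finset.sum_congr rfl fun k hk => ?_
        rw [hup k hk, betGain, NNReal.coe_zero]
        ring

end Hedging

/-! ### The expectations of the waiting time -/

theorem coe_one_div_nnreal {a : ℝ≥0} (ha : a ≠ 0) :
    ((1 / (a : ℝ≥0∞) : ℝ≥0∞) : EReal) = ((1 / a : ℝ) : EReal) := by
  have : (1 / (a : ℝ≥0∞)) = ((1 / a : ℝ≥0) : ℝ≥0∞) := by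
    rw [ENNReal.coe_div ha, ENNReal.coe_one]
  rw [this, EReal.coe_nnreal_eq_coe_real]
  push_cast
  rfl

theorem upperExp_waitingTime {lo hi : ℝ≥0} (hle : lo ≤ hi) {τ : CountingPath → ℝ≥0∞}
    (hτ : IsStopTime τ) {ω : CountingPath} {s : ℝ≥0} (hs : τ ω = s) :
    upperExp lo hi τ (waitingTime τ) ω = ((1 / (lo : ℝ≥0∞) : ℝ≥0∞) : EReal) := by
  rcases eq_or_ne lo 0 with rfl | hlo
  · -- on the path without jumps after `τ` the waiting time is infinite, but capital cannot grow
    have htop : ((1 / ((0 : ℝ≥0) : ℝ≥0∞) : ℝ≥0∞) : EReal) = ⊤ := by simp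
    rw [htop, upperExp, sInf_eq_top]
    rintro x ⟨K, ⟨G, c, rfl⟩, -, hdom, -⟩
    exfalso
    have hag : ∀ t ≤ s, splice ω s zeroPath t = ω t := fun t ht => splice_apply_of_le _ _ ht
    have hconst : ∀ t, s ≤ t → splice ω s zeroPath t = splice ω s zeroPath s := fun t ht => by
      rw [hag s le_rfl, splice_apply_of_ge _ _ ht]; rfl
    have h1 := hdom (splice ω s zeroPath)
      (fun t ht => hag t (by rw [hs] at ht; exact_mod_cast ht))
    have hτ₀ : τ (splice ω s zeroPath) = s := (hτ.eq_of_agree hag hs.le).trans hs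
    rw [waitingTime_eq_top hτ₀ (nextJump_eq_top hτ₀ hconst), top_le_iff] at h1
    have h2 : liminf (fun t : ℝ≥0 => ((capital 0 hi G c t (splice ω s zeroPath) : ℝ) : EReal)) atTop
        ≤ ((capital 0 hi G c s (splice ω s zeroPath) : ℝ) : EReal) := by
      refine liminf_le_of_frequently_le' (Eventually.frequently ?_)
      filter_upwards [eventually_ge_atTop s] with t ht
      exact_mod_cast capital_le_of_no_jump G c hconst ht
    rw [h1, top_le_iff] at h2
    exact EReal.coe_ne_top _ h2
  · rw [coe_one_div_nnreal hlo]
    refine le_antisymm (upperExp_waitingTime_le hi (pos_iff_ne_zero.2 hlo) hτ hs) (le_sInf ?_)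
    rintro x ⟨K, ⟨G, c, rfl⟩, ⟨b, hb⟩, hdom, rfl⟩
    rw [hs, ENNReal.toNNReal_coe, EReal.coe_le_coe_iff]
    refine div_le_capital le_rfl hle (pos_iff_ne_zero.2 hlo) hτ hs G c hb 1 fun ϖ hϖ r hr => ?_
    rw [one_mul, ← waitingTime_eq_coe ((hτ ω ϖ hϖ).trans hs) hr]
    exact hdom ϖ hϖ

theorem lowerExp_waitingTime {lo hi : ℝ≥0} (hle : lo ≤ hi) {τ : CountingPath → ℝ≥0∞}
    (hτ : IsStopTime τ) {ω : CountingPath} {s : ℝ≥0} (hs : τ ω = s) :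
    lowerExp lo hi τ (waitingTime τ) ω = ((1 / (hi : ℝ≥0∞) : ℝ≥0∞) : EReal) := by
  rw [lowerExp, neg_eq_iff_eq_neg]
  rcases eq_or_ne hi 0 with rfl | hhi
  · have htop : ((1 / ((0 : ℝ≥0) : ℝ≥0∞) : ℝ≥0∞) : EReal) = ⊤ := by simp
    rw [htop, EReal.neg_top, EReal.eq_bot_iff_forall_lt]
    intro y
    refine (upperExp_neg_waitingTime_le_neg lo hτ hs (1 + y.toNNReal + (-y).toNNReal)).trans_lt ?_
    rw [EReal.coe_lt_coe_iff]
    have h1 := Real.le_coe_toNNReal (-y)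
    have h2 : (0 : ℝ) ≤ y.toNNReal := NNReal.coe_nonneg _
    push_cast at h1 ⊢
    linarith
  · have hpos : 0 < hi := pos_iff_ne_zero.2 hhi
    rw [coe_one_div_nnreal hhi, ← EReal.coe_neg]
    refine le_antisymm ?_ (le_sInf ?_)
    · have hlim : Tendsto (fun M : ℕ => (-1 + 1 / 2 ^ M) / (hi : ℝ)) atTop
          (nhds (-(1 / hi : ℝ))) := by
        have h1 : Tendsto (fun M : ℕ => (1 / 2 ^ M : ℝ)) atTop (nhds 0) := by
          simpa using tendsto_pow_atTop_nhds_zero_of_lt_one (r := (1 / 2 : ℝ))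
            (by norm_num) (by norm_num)
        have h2 := (h1.const_add (-1)).div_const (hi : ℝ)
        rwa [add_zero, neg_div] at h2
      exact ge_of_tendsto' (EReal.tendsto_coe.2 hlim)
        fun M => upperExp_neg_waitingTime_le lo hpos hτ hs M
    · rintro x ⟨K, ⟨G, c, rfl⟩, ⟨b, hb⟩, hdom, rfl⟩
      rw [hs, ENNReal.toNNReal_coe, EReal.coe_le_coe_iff, ← neg_div]
      refine div_le_capital hle le_rfl hpos hτ hs G c hb (-1) fun ϖ hϖ r hr => ?_
      rw [neg_one_mul, EReal.coe_neg, ← waitingTime_eq_coe ((hτ ω ϖ hϖ).trans hs) hr]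
      exact hdom ϖ hϖ

end ImprecisePoisson

end

theorem mainTheorem5 (lo hi : ℝ≥0) (hle : lo ≤ hi)
    (τ : ImprecisePoisson.CountingPath → ℝ≥0∞) (hτ : ImprecisePoisson.IsStopTime τ)
    (ω : ImprecisePoisson.CountingPath) (hω : τ ω < ⊤) :
    ImprecisePoisson.upperExp lo hi τ (ImprecisePoisson.waitingTime τ) ω
        = ((1 / (lo : ℝ≥0∞) : ℝ≥0∞) : EReal) ∧
      ImprecisePoisson.lowerExp lo hi τ (ImprecisePoisson.waitingTime τ) ω
        = ((1 / (hi : ℝ≥0∞) : ℝ≥0∞) : EReal) := by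
  have hs : τ ω = (τ ω).toNNReal := (ENNReal.coe_toNNReal hω.ne).symm
  exact ⟨ImprecisePoisson.upperExp_waitingTime hle hτ hs,
    ImprecisePoisson.lowerExp_waitingTime hle hτ hs⟩
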